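/- Let $\mathbb S^2\subset\mathbb R^3$ be the unit sphere with its round metric $g_0$, polar angle $\theta\in[0,\pi]$ and azimuth $\varphi\in(-\pi,\pi]$, and let $\mathcal N=(0,0,1)$, $\mathcal S=(0,0,-1)$. For $n\ge 1$ put $\varphi_n=1/(n\pi)$, let $q_n$ be the point with $\theta=\pi/2$, $\varphi=\varphi_n$, and $p_n$ the point with $\theta=\pi/2$, $\varphi=(\varphi_n+\varphi_{n+1})/2$. Let $\Omega\in C^\infty(\mathbb S^2)$ satisfy: (a) $\Omega\ge 1$; (b) $\Omega=1$ on the meridians of azimuth $\varphi_n$, $n\ge1$; (c) for some $0<\varepsilon'<\varepsilon''<\pi/2$ one has $\Omega=1$ where $|\theta-\pi/2|>\varepsilon''$, and $\Omega>1$ where $|\theta-\pi/2|<\varepsilon'$, $0<\varphi<\pi/2$ and $\varphi\ne\varphi_n$ for all $n\ge1$. Then there exist strictly decreasing sequences of positive numbers $\nu_n\to0$ and $\varepsilon_n\to0$ such that, denoting by $V_n$ the open $g_0$-ball of diameter $\varepsilon_n$ centred at $q_n$, the closures $\overline{V}_n$ are pairwise disjoint and contain no $p_m$, and the following holds. Call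 $f\in C^\infty(\mathbb S^2)$ admissible if $f\ge0$, $f=0$ outside $\bigcup_n V_n$, and $f(q_n)>0$ and $f\le\nu_n$ on $V_n$ for every $n$. Admissible functions exist; and for every admissible $f$ the function $\tilde\Omega=\Omega-f$ is positive and, with $g^\star=\tilde\Omega g_0$, there is no absolutely continuous curve $\gamma:[a,b]\to\mathbb S^2$ from $\mathcal N$ to $\mathcal S$ which passes through $p_n$ for some $n\ge1$ and has $g^\star$-length $L_{g^\star}(\gamma)\le\pi$. -/

import Mathlib

open Set Filter Topology MeasureTheory
open scoped Manifold ContDiff ENNReal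

noncomputable section

namespace SphereExample

/-- Euclidean three-space. -/
abbrev E3 : Type := EuclideanSpace ℝ (Fin 3)

/-- The unit sphere of Euclidean three-space, with Mathlib's smooth structure. -/
abbrev S2 : Type := Metric.sphere (0 : E3) 1

/-- The point with polar angle `θ` and azimuth `φ`. -/
def pt (θ φ : ℝ) : S2 :=
  ⟨!₂[Real.sin θ * Real.cos φ, Real.sin θ * Real.sin φ, Real.cos θ], by
    rw [mem_sphere_zero_iff_norm, EuclideanSpace.norm_eq, Real.sqrt_eq_one]
    simp only [Fin.sum_univ_three, Real.norm_eq_abs, sq_abs]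
    simp only [Matrix.cons_val_zero, Matrix.cons_val_one, Matrix.cons_val]
    nlinarith [Real.sin_sq_add_cos_sq θ, Real.sin_sq_add_cos_sq φ]⟩

/-- The north pole `(0, 0, 1)`. -/
def northPole : S2 :=
  ⟨!₂[0, 0, 1], by
    rw [mem_sphere_zero_iff_norm, EuclideanSpace.norm_eq]
    simp [Fin.sum_univ_three]⟩

/-- The south pole `(0, 0, -1)`. -/
def southPole : S2 :=
  ⟨!₂[0, 0, -1], by
    rw [mem_sphere_zero_iff_norm, EuclideanSpace.norm_eq]
    simp [Fin.sum_univ_three]⟩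

/-- The azimuths `1/π, 1/(2π), 1/(3π), …`; the sequence is indexed from `0`, so that the index `n`
here stands for the positive integer `n + 1`. -/
def azimuth (n : ℕ) : ℝ := 1 / (((n : ℝ) + 1) * Real.pi)

/-- The equatorial point of the meridian of azimuth `azimuth n`. -/
def q (n : ℕ) : S2 := pt (Real.pi / 2) (azimuth n)

/-- The equatorial point midway between `q n` and `q (n + 1)`. -/
def p (n : ℕ) : S2 := pt (Real.pi / 2) ((azimuth n + azimuth (n + 1)) / 2)

/-- The open ball of centre `c` and radius `r` for the distance of the round metric `g₀`, which is
the angle between the two position vectors. -/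
def geoBall (c : S2) (r : ℝ) : Set S2 :=
  {x | InnerProductGeometry.angle (c : E3) (x : E3) < r}

/-- The length of the curve `γ : [a, b] → S2` in the metric `h g₀`, i.e. the integral of
`√(h(γ(t)) g₀(γ'(t), γ'(t)))`. -/
def conformalLength (h : S2 → ℝ) (γ : ℝ → S2) (a b : ℝ) : ℝ≥0∞ :=
  ∫⁻ t in Icc a b, ENNReal.ofReal (√(h (γ t) * ‖deriv (fun s => (γ s : E3)) t‖ ^ 2))

/-- The properties required of the original conformal factor `Ω`. -/
structure IsBaseFactor (Ω : S2 → ℝ) : Prop where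
  smooth : ContMDiff (𝓡 2) 𝓘(ℝ, ℝ) ∞ Ω
  one_le : ∀ x, 1 ≤ Ω x
  eq_one_meridian : ∀ n : ℕ, ∀ θ ∈ Icc 0 Real.pi, Ω (pt θ (azimuth n)) = 1
  band : ∃ ε₁ ε₂ : ℝ, 0 < ε₁ ∧ ε₁ < ε₂ ∧ ε₂ < Real.pi / 2 ∧
    (∀ θ ∈ Icc 0 Real.pi, ∀ φ : ℝ, ε₂ < |θ - Real.pi / 2| → Ω (pt θ φ) = 1) ∧
    (∀ θ φ : ℝ, |θ - Real.pi / 2| < ε₁ → 0 < φ → φ < Real.pi / 2 → (∀ n, φ ≠ azimuth n) →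
      1 < Ω (pt θ φ))

/-- The region `V n`: the `g₀`-ball of diameter `ε n` about `q n`. -/
def V (ε : ℕ → ℝ) (n : ℕ) : Set S2 := geoBall (q n) (ε n / 2)

/-- The requirements on the sequences `ν` (heights) and `ε` (diameters). -/
structure IsChoice (ν ε : ℕ → ℝ) : Prop where
  ν_pos : ∀ n, 0 < ν n
  ν_anti : StrictAnti ν
  ν_lim : Tendsto ν atTop (𝓝 0)
  ε_pos : ∀ n, 0 < ε n
  ε_anti : StrictAnti ε
  ε_lim : Tendsto ε atTop (𝓝 0)
  p_notMem : ∀ m n, p m ∉ closure (V ε n)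
  disj : ∀ m n, m ≠ n → Disjoint (closure (V ε m)) (closure (V ε n))

/-- The requirements on the function `f` that is subtracted from `Ω`. -/
structure IsBump (ν ε : ℕ → ℝ) (f : S2 → ℝ) : Prop where
  smooth : ContMDiff (𝓡 2) 𝓘(ℝ, ℝ) ∞ f
  nonneg : ∀ x, 0 ≤ f x
  eq_zero : ∀ x, (∀ n, x ∉ V ε n) → f x = 0
  pos : ∀ n, 0 < f (q n)
  le : ∀ n, ∀ x ∈ V ε n, f x ≤ ν n

end SphereExample

end

/-!
Write `L` for the length in `g⋆` of a curve `γ` from `𝒩` to `𝒮` through some `p n`. The length of a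
curve in `c g₀` is at least `√c` times the sum of the angles between successive points on it, and
any point of the equator is at angle `π / 2` from both poles.

If `γ` meets no `V k`, then `g⋆ = Ω g₀` along `γ`, and `Ω ≥ 1` with `Ω > 1` near `p n` makes
`L > π`. Otherwise let `k` be the smallest index with `γ` meeting `V k`. The detour between `V k`
and `p n` costs at least `ε k` in the round metric, while `f ≤ ν k` along `γ` because `ν` is
decreasing, so that `L ≥ √(1 - ν k) (π + ε k)`. This exceeds `π` once `ν k` is a small multiple of
`ε k`.
-/

open InnerProductGeometry

namespace SphereExample

section AbsolutelyContinuous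

theorem absolutelyContinuousOnInterval_of_dist_le_mul {X Y : Type*} [PseudoMetricSpace X]
    [PseudoMetricSpace Y] {f : ℝ → X} {g : ℝ → Y} {a b K : ℝ}
    (hg : AbsolutelyContinuousOnInterval g a b)
    (h : ∀ s t, dist (f s) (f t) ≤ K * dist (g s) (g t)) :
    AbsolutelyContinuousOnInterval f a b := by
  unfold AbsolutelyContinuousOnInterval at hg ⊢
  have hKg := hg.const_mul K
  rw [mul_zero] at hKg
  refine squeeze_zero (fun _ => Finset.sum_nonneg fun _ _ => dist_nonneg) (fun _ => ?_) hKg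
  rw [Finset.mul_sum]
  exact Finset.sum_le_sum fun _ _ => h _ _

theorem enorm_sub_le_lintegral_enorm_deriv {w : ℝ → ℝ} {a b : ℝ} (hab : a ≤ b)
    (hw : AbsolutelyContinuousOnInterval w a b) :
    ‖w b - w a‖ₑ ≤ ∫⁻ t in Icc a b, ‖deriv w t‖ₑ := by
  rw [← hw.integral_deriv_eq_sub, intervalIntegral.integral_of_le hab,
    ← integral_Icc_eq_integral_Ioc]
  exact enorm_integral_le_lintegral_enorm _

end AbsolutelyContinuous

section UnitVectors

variable {E : Type*} [NormedAddCommGroup E] [InnerProductSpace ℝ E]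

theorem norm_sub_eq_two_mul_sin_half_angle {x y : E} (hx : ‖x‖ = 1) (hy : ‖y‖ = 1) :
    ‖x - y‖ = 2 * Real.sin (angle x y / 2) := by
  have hsq : ‖x - y‖ ^ 2 = 2 ^ 2 * ((1 - Real.cos (angle x y)) / 2) := by
    rw [norm_sub_sq_real, ← cos_angle_mul_norm_mul_norm, hx, hy]
    ring
  rw [Real.sin_half_eq_sqrt (angle_nonneg x y) (by linarith [angle_le_pi x y, Real.pi_pos]),
    ← Real.sqrt_sq (norm_nonneg (x - y)), hsq, Real.sqrt_mul (by norm_num),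
    Real.sqrt_sq zero_le_two]

theorem angle_eq_two_mul_arcsin {x y : E} (hx : ‖x‖ = 1) (hy : ‖y‖ = 1) :
    angle x y = 2 * Real.arcsin (‖x - y‖ / 2) := by
  rw [norm_sub_eq_two_mul_sin_half_angle hx hy, mul_div_cancel_left₀ _ two_ne_zero,
    Real.arcsin_sin (by linarith [angle_nonneg x y, Real.pi_pos]) (by linarith [angle_le_pi x y])]
  ring

theorem norm_sub_le_angle {x y : E} (hx : ‖x‖ = 1) (hy : ‖y‖ = 1) : ‖x - y‖ ≤ angle x y := by
  rw [norm_sub_eq_two_mul_sin_half_angle hx hy]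
  linarith [Real.sin_le (x := angle x y / 2) (by linarith [angle_nonneg x y])]

theorem angle_le_pi_div_two_mul_norm_sub {x y : E} (hx : ‖x‖ = 1) (hy : ‖y‖ = 1) :
    angle x y ≤ Real.pi / 2 * ‖x - y‖ := by
  have hjordan : 2 / Real.pi * (angle x y / 2) ≤ Real.sin (angle x y / 2) :=
    Real.mul_le_sin (by linarith [angle_nonneg x y]) (by linarith [angle_le_pi x y])
  calc angle x y = Real.pi * (2 / Real.pi * (angle x y / 2)) := by field_simp
    _ ≤ Real.pi * Real.sin (angle x y / 2) := by gcongr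
    _ = Real.pi / 2 * ‖x - y‖ := by rw [norm_sub_eq_two_mul_sin_half_angle hx hy]; ring

theorem abs_angle_sub_angle_le (o x y : E) : |angle o x - angle o y| ≤ angle x y := by
  rw [abs_sub_le_iff]
  constructor
  · linarith [angle_le_angle_add_angle o y x, angle_comm x y]
  · linarith [angle_le_angle_add_angle o x y]

theorem isEquivalent_two_mul_arcsin_half :
    Asymptotics.IsEquivalent (𝓝 0) (fun u : ℝ => 2 * Real.arcsin (u / 2)) id := by
  have hderiv : HasDerivAt (fun u : ℝ => 2 * Real.arcsin (u / 2)) 1 0 := by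
    have harcsin : HasDerivAt Real.arcsin 1 ((0 : ℝ) / 2) := by
      simpa using Real.hasDerivAt_arcsin (x := 0) (by norm_num) (by norm_num)
    simpa using (harcsin.comp 0 ((hasDerivAt_id (0 : ℝ)).div_const 2)).const_mul 2
  simpa [Asymptotics.IsEquivalent, Function.id_def, Pi.sub_def] using
    hasDerivAt_iff_isLittleO.1 hderiv

variable {γ : ℝ → E}

theorem tendsto_angle_div_abs_sub (hγ : ∀ s, ‖γ s‖ = 1) {γ' : E} {t : ℝ}
    (hγ' : HasDerivAt γ γ' t) :
    Tendsto (fun s => angle (γ s) (γ t) / |s - t|) (𝓝[≠] t) (𝓝 ‖γ'‖) := by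
  have hchord : Tendsto (fun s => ‖γ s - γ t‖) (𝓝[≠] t) (𝓝 0) := by
    have hcont : ContinuousAt (fun s => ‖γ s - γ t‖) t :=
      (hγ'.continuousAt.sub continuousAt_const).norm
    simpa using hcont.tendsto.mono_left nhdsWithin_le_nhds
  have hequiv : Asymptotics.IsEquivalent (𝓝[≠] t) (fun s => angle (γ s) (γ t))
      fun s => ‖γ s - γ t‖ := by
    simp only [fun s => angle_eq_two_mul_arcsin (hγ s) (hγ t)]
    exact isEquivalent_two_mul_arcsin_half.comp_tendsto hchord
  refine (hequiv.div (.refl (u := fun s => |s - t|))).symm.tendsto_nhds ?_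
  refine hγ'.tendsto_slope.norm.congr fun s => ?_
  rw [slope_def_module, norm_smul, norm_inv, Real.norm_eq_abs, inv_mul_eq_div]
  rfl

theorem abs_deriv_angle_le (hγ : ∀ s, ‖γ s‖ = 1) (o : E) {t : ℝ}
    (hangle : DifferentiableAt ℝ (fun s => angle o (γ s)) t) (hγt : DifferentiableAt ℝ γ t) :
    |deriv (fun s => angle o (γ s)) t| ≤ ‖deriv γ t‖ := by
  refine le_of_tendsto_of_tendsto' hangle.hasDerivAt.tendsto_slope.abs
    (tendsto_angle_div_abs_sub hγ hγt.hasDerivAt) fun s => ?_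
  rw [slope_def_field, abs_div]
  gcongr
  exact abs_angle_sub_angle_le o (γ s) (γ t)

theorem absolutelyContinuousOnInterval_angle (hγ : ∀ s, ‖γ s‖ = 1) (o : E) {a b : ℝ}
    (hac : AbsolutelyContinuousOnInterval γ a b) :
    AbsolutelyContinuousOnInterval (fun t => angle o (γ t)) a b :=
  absolutelyContinuousOnInterval_of_dist_le_mul hac fun s t => by
    rw [Real.dist_eq, dist_eq_norm]
    exact (abs_angle_sub_angle_le o _ _).trans (angle_le_pi_div_two_mul_norm_sub (hγ s) (hγ t))

theorem ofReal_angle_le_lintegral_enorm_deriv [FiniteDimensional ℝ E] (hγ : ∀ s, ‖γ s‖ = 1)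
    {a b : ℝ} (hab : a ≤ b) (hac : AbsolutelyContinuousOnInterval γ a b) :
    ENNReal.ofReal (angle (γ a) (γ b)) ≤ ∫⁻ t in Icc a b, ‖deriv γ t‖ₑ := by
  have hangle := absolutelyContinuousOnInterval_angle hγ (γ a) hac
  have hself : angle (γ a) (γ a) = 0 := angle_self (norm_ne_zero_iff.1 (by simp [hγ]))
  calc ENNReal.ofReal (angle (γ a) (γ b)) = ‖angle (γ a) (γ b) - angle (γ a) (γ a)‖ₑ := by
        rw [hself, sub_zero, Real.enorm_of_nonneg (angle_nonneg _ _)]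
    _ ≤ ∫⁻ t in Icc a b, ‖deriv (fun s => angle (γ a) (γ s)) t‖ₑ :=
        enorm_sub_le_lintegral_enorm_deriv hab hangle
    _ ≤ ∫⁻ t in Icc a b, ‖deriv γ t‖ₑ := by
        refine lintegral_mono_ae ((ae_restrict_iff' measurableSet_Icc).2 ?_)
        filter_upwards [hac.boundedVariationOn.ae_differentiableAt_of_mem_uIcc,
          hangle.boundedVariationOn.ae_differentiableAt_of_mem_uIcc] with t hγt hanglet ht
        rw [← uIcc_of_le hab] at ht
        exact enorm_le_iff_norm_le.2 (abs_deriv_angle_le hγ _ (hanglet ht) (hγt ht))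

end UnitVectors

theorem exists_Icc_mapsTo_of_mem_nhds {X : Type*} [TopologicalSpace X] [T1Space X] {γ : ℝ → X}
    {a b : ℝ} (hab : a ≤ b) (hγ : ContinuousOn γ (Icc a b)) (hne : γ a ≠ γ b) {U : Set X}
    (hU : U ∈ 𝓝 (γ b)) :
    ∃ s ∈ Icc a b, ∃ t ∈ Icc a b, s ≤ t ∧ γ s ≠ γ t ∧ MapsTo γ (Icc s t) U := by
  -- `t` is the first time at which `γ` reaches `γ b`, so that `γ s ≠ γ t` for every `s < t`.
  obtain ⟨t, ⟨ht, htb⟩, hfirst⟩ : ∃ t, IsLeast (Icc a b ∩ γ ⁻¹' {γ b}) t :=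
    (isCompact_Icc.of_isClosed_subset
      (hγ.preimage_isClosed_of_isClosed isClosed_Icc isClosed_singleton)
      inter_subset_left).exists_isLeast ⟨b, right_mem_Icc.2 hab, rfl⟩
  have hat : a < t := ht.1.lt_of_ne (by rintro rfl; exact hne htb)
  have hmem : γ ⁻¹' U ∈ 𝓝[Icc a t] t :=
    ((hγ t ht).mono (Icc_subset_Icc_right ht.2)).preimage_mem_nhdsWithin (by rwa [htb])
  rw [nhdsWithin_Icc_eq_nhdsLE hat, mem_nhdsLE_iff_exists_mem_Ico_Ioc_subset hat] at hmem
  obtain ⟨l, hl, hlU⟩ := hmem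
  obtain ⟨s, hls, hst⟩ := exists_between hl.2
  have hs : s ∈ Icc a b := ⟨hl.1.trans hls.le, hst.le.trans ht.2⟩
  exact ⟨s, hs, t, ht, hst.le, fun h => hst.not_ge (hfirst ⟨hs, h.trans htb⟩),
    fun u hu => hlU ⟨hls.trans_le hu.1, hu.2⟩⟩

section ConformalLength

variable {g h : S2 → ℝ} {γ : ℝ → S2} {a b c : ℝ}

theorem conformalLength_mono (hgh : ∀ t ∈ Icc a b, g (γ t) ≤ h (γ t)) :
    conformalLength g γ a b ≤ conformalLength h γ a b :=
  setLIntegral_mono' measurableSet_Icc fun t ht => by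
    gcongr
    exact hgh t ht

theorem conformalLength_add {s : ℝ} (has : a ≤ s) (hsb : s ≤ b) :
    conformalLength h γ a s + conformalLength h γ s b = conformalLength h γ a b := by
  unfold conformalLength
  rw [setLIntegral_congr (Ico_ae_eq_Icc (a := a) (b := s)).symm,
    ← lintegral_union measurableSet_Icc, Ico_union_Icc_eq_Icc has hsb]
  exact disjoint_left.2 fun _ hx hx' => hx.2.not_ge hx'.1

theorem ofReal_sqrt_mul_angle_le_conformalLength (hab : a ≤ b)
    (hγ : AbsolutelyContinuousOnInterval γ a b) (hc : ∀ t ∈ Icc a b, c ≤ h (γ t)) :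
    ENNReal.ofReal (√c * angle (γ a : E3) (γ b)) ≤ conformalLength h γ a b := by
  have hround : ENNReal.ofReal (angle (γ a : E3) (γ b)) ≤
      ∫⁻ t in Icc a b, ‖deriv (fun s => (γ s : E3)) t‖ₑ :=
    ofReal_angle_le_lintegral_enorm_deriv (γ := fun s => (γ s : E3))
      (fun s => norm_eq_of_mem_sphere (γ s)) hab hγ
  calc ENNReal.ofReal (√c * angle (γ a : E3) (γ b))
      ≤ ENNReal.ofReal √c * ∫⁻ t in Icc a b, ‖deriv (fun s => (γ s : E3)) t‖ₑ := by
        rw [ENNReal.ofReal_mul c.sqrt_nonneg]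
        gcongr
    _ = ∫⁻ t in Icc a b, ENNReal.ofReal √c * ‖deriv (fun s => (γ s : E3)) t‖ₑ :=
        (lintegral_const_mul' _ _ ENNReal.ofReal_ne_top).symm
    _ ≤ conformalLength h γ a b := by
        refine setLIntegral_mono' measurableSet_Icc fun t ht => ?_
        rw [← ofReal_norm, ← ENNReal.ofReal_mul c.sqrt_nonneg, Real.sqrt_mul' _ (sq_nonneg _),
          Real.sqrt_sq (norm_nonneg _)]
        gcongr
        exact hc t ht

theorem ofReal_three_arcs_le_conformalLength (hγ : AbsolutelyContinuousOnInterval γ a b)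
    (hc : ∀ u ∈ Icc a b, c ≤ h (γ u)) {s t d : ℝ} (hs : s ∈ Icc a b) (ht : t ∈ Icc a b)
    (hst : s ≤ t) (hd : ∀ u ∈ Icc s t, d ≤ h (γ u)) :
    ENNReal.ofReal (√c * angle (γ a : E3) (γ s) + √d * angle (γ s : E3) (γ t) +
      √c * angle (γ t : E3) (γ b)) ≤ conformalLength h γ a b := by
  have hab : a ≤ b := hs.1.trans hs.2
  have hac : ∀ {r u}, r ∈ Icc a b → u ∈ Icc a b → AbsolutelyContinuousOnInterval γ r u :=
    fun hr hu => hγ.mono (uIcc_of_le hab ▸ uIcc_subset_Icc hr hu)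
  grw [← conformalLength_add hs.1 hs.2, ← conformalLength_add hst ht.2, ← add_assoc,
    ENNReal.ofReal_add_le, ENNReal.ofReal_add_le,
    ofReal_sqrt_mul_angle_le_conformalLength hs.1 (hac (left_mem_Icc.2 hab) hs)
      fun u hu => hc u ⟨hu.1, hu.2.trans hs.2⟩,
    ofReal_sqrt_mul_angle_le_conformalLength hst (hac hs ht) hd,
    ofReal_sqrt_mul_angle_le_conformalLength ht.2 (hac ht (right_mem_Icc.2 hab))
      fun u hu => hc u ⟨ht.1.trans hu.1, hu.2⟩]

theorem ofReal_angle_lt_conformalLength (hab : a ≤ b) (hγ : AbsolutelyContinuousOnInterval γ a b)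
    (hh : LowerSemicontinuous h) (hone : ∀ u ∈ Icc a b, 1 ≤ h (γ u)) (hne : γ a ≠ γ b)
    (hb : 1 < h (γ b)) :
    ENNReal.ofReal (angle (γ a : E3) (γ b)) < conformalLength h γ a b := by
  obtain ⟨d, hd, hdb⟩ := exists_between hb
  have hcont : ContinuousOn γ (Icc a b) := by
    rw [← uIcc_of_le hab, Topology.IsInducing.subtypeVal.continuousOn_iff]
    exact AbsolutelyContinuousOnInterval.continuousOn (f := fun u => (γ u : E3)) hγ
  obtain ⟨s, hs, t, ht, hst, hst', hdst⟩ :=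
    exists_Icc_mapsTo_of_mem_nhds hab hcont hne (hh (γ b) d hdb : {x | d < h x} ∈ 𝓝 (γ b))
  have hpos : 0 < angle (γ s : E3) (γ t) :=
    (norm_pos_iff.2 (sub_ne_zero.2 (Subtype.coe_ne_coe.2 hst'))).trans_le
      (norm_sub_le_angle (norm_eq_of_mem_sphere _) (norm_eq_of_mem_sphere _))
  have htriangle : angle (γ a : E3) (γ b) ≤
      angle (γ a : E3) (γ s) + angle (γ s : E3) (γ t) + angle (γ t : E3) (γ b) := by
    linarith [angle_le_angle_add_angle (γ a : E3) (γ s) (γ b),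
      angle_le_angle_add_angle (γ s : E3) (γ t) (γ b)]
  have hgain : angle (γ s : E3) (γ t) < √d * angle (γ s : E3) (γ t) :=
    lt_mul_of_one_lt_left hpos (Real.lt_sqrt_of_sq_lt (by rwa [one_pow]))
  refine lt_of_lt_of_le ?_ (ofReal_three_arcs_le_conformalLength hγ hone hs ht hst
    fun u hu => (hdst hu).le)
  rw [ENNReal.ofReal_lt_ofReal_iff_of_nonneg (angle_nonneg _ _), Real.sqrt_one]
  linarith

end ConformalLength

section Equator

theorem angle_northPole_equator (φ : ℝ) :
    angle (northPole : E3) (pt (Real.pi / 2) φ) = Real.pi / 2 := by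
  rw [← inner_eq_zero_iff_angle_eq_pi_div_two]
  simp [pt, northPole, PiLp.inner_apply, Fin.sum_univ_three]

theorem angle_equator_southPole (φ : ℝ) :
    angle (pt (Real.pi / 2) φ : E3) southPole = Real.pi / 2 := by
  rw [← inner_eq_zero_iff_angle_eq_pi_div_two]
  simp [pt, southPole, PiLp.inner_apply, Fin.sum_univ_three]

theorem angle_equator_equator {φ φ' : ℝ} (h : |φ - φ'| ≤ Real.pi) :
    angle (pt (Real.pi / 2) φ : E3) (pt (Real.pi / 2) φ') = |φ - φ'| := by
  rw [angle, norm_eq_of_mem_sphere, norm_eq_of_mem_sphere, ← Real.arccos_cos (abs_nonneg _) h,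
    Real.cos_abs, Real.cos_sub]
  congr 1
  simp only [pt, Real.sin_pi_div_two, one_mul, Real.cos_pi_div_two, PiLp.inner_apply,
    RCLike.inner_apply, Real.ringHom_apply, Fin.sum_univ_three, Matrix.cons_val_zero,
    Matrix.cons_val_one, Matrix.cons_val, mul_zero, add_zero, mul_one, div_one]
  ring

theorem pi_add_angle_equator_sub_le (φ φ' : ℝ) (x y : S2) :
    Real.pi + angle (pt (Real.pi / 2) φ : E3) (pt (Real.pi / 2) φ') -
        2 * (angle (pt (Real.pi / 2) φ : E3) x + angle (pt (Real.pi / 2) φ' : E3) y) ≤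
      angle (northPole : E3) x + angle (x : E3) y + angle (y : E3) southPole := by
  set P : E3 := ((pt (Real.pi / 2) φ : S2) : E3)
  set P' : E3 := ((pt (Real.pi / 2) φ' : S2) : E3)
  have hNP : angle (northPole : E3) P = Real.pi / 2 := angle_northPole_equator φ
  have hPS : angle P' (southPole : E3) = Real.pi / 2 := angle_equator_southPole φ'
  linarith [angle_le_angle_add_angle (northPole : E3) x P, angle_le_angle_add_angle P x P',
    angle_le_angle_add_angle (x : E3) y P', angle_le_angle_add_angle P' y (southPole : E3),
    angle_comm (x : E3) P, angle_comm (y : E3) P']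

end Equator

section GeoBall

theorem angle_coe_self (x : S2) : angle (x : E3) x = 0 :=
  angle_self (norm_ne_zero_iff.1 (by simp))

theorem continuous_angle_right (o : S2) : Continuous fun x : S2 => angle (o : E3) x := by
  simp only [angle, norm_eq_of_mem_sphere]
  fun_prop

theorem isOpen_geoBall (o : S2) (r : ℝ) : IsOpen (geoBall o r) :=
  isOpen_lt (continuous_angle_right o) continuous_const

theorem mem_geoBall_self {o : S2} {r : ℝ} (hr : 0 < r) : o ∈ geoBall o r := by
  rwa [geoBall, mem_ofPred_eq, angle_coe_self]

theorem angle_le_of_mem_closure_geoBall {o x : S2} {r : ℝ} (hx : x ∈ closure (geoBall o r)) :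
    angle (o : E3) x ≤ r :=
  closure_lt_subset_le (continuous_angle_right o) continuous_const hx

theorem disjoint_closure_geoBall {o o' : S2} {r r' : ℝ} (h : r + r' < angle (o : E3) o') :
    Disjoint (closure (geoBall o r)) (closure (geoBall o' r')) := by
  refine disjoint_left.2 fun x hx hx' => ?_
  linarith [angle_le_angle_add_angle (o : E3) x o', angle_comm (x : E3) o',
    angle_le_of_mem_closure_geoBall hx, angle_le_of_mem_closure_geoBall hx']

end GeoBall

section Azimuth

theorem azimuth_pos (n : ℕ) : 0 < azimuth n := by
  unfold azimuth
  positivity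

theorem azimuth_strictAnti : StrictAnti azimuth := fun m n hmn => by
  unfold azimuth
  gcongr

theorem azimuth_lt_one (n : ℕ) : azimuth n < 1 := by
  refine (azimuth_strictAnti.antitone n.zero_le).trans_lt ?_
  rw [azimuth, div_lt_one (by positivity), Nat.cast_zero]
  linarith [Real.pi_gt_three]

theorem tendsto_azimuth : Tendsto azimuth atTop (𝓝 0) := by
  have h := (tendsto_one_div_add_atTop_nhds_zero_nat (𝕜 := ℝ)).div_const Real.pi
  rw [zero_div] at h
  exact h.congr fun n => div_div _ _ _

/-- The azimuth of the point `p n`. -/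
noncomputable def midAzimuth (n : ℕ) : ℝ := (azimuth n + azimuth (n + 1)) / 2

theorem midAzimuth_pos (n : ℕ) : 0 < midAzimuth n := by
  unfold midAzimuth
  linarith [azimuth_pos n, azimuth_pos (n + 1)]

theorem midAzimuth_lt_one (n : ℕ) : midAzimuth n < 1 := by
  unfold midAzimuth
  linarith [azimuth_lt_one n, azimuth_lt_one (n + 1)]

/-- The diameter `ε n` of the ball `V n`, a quarter of the gap between consecutive azimuths. -/
noncomputable def ballDiam (n : ℕ) : ℝ := (azimuth n - azimuth (n + 1)) / 4

theorem ballDiam_eq (n : ℕ) : ballDiam n = 1 / (4 * Real.pi * ((n + 1) * (n + 2))) := by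
  unfold ballDiam azimuth
  push_cast
  field_simp
  ring

theorem ballDiam_pos (n : ℕ) : 0 < ballDiam n := by
  rw [ballDiam_eq]
  positivity

theorem ballDiam_strictAnti : StrictAnti ballDiam := fun m n hmn => by
  rw [ballDiam_eq, ballDiam_eq]
  gcongr

theorem tendsto_ballDiam : Tendsto ballDiam atTop (𝓝 0) := by
  have h := (tendsto_azimuth.sub (tendsto_azimuth.comp (tendsto_add_atTop_nat 1))).div_const 4
  rwa [sub_zero, zero_div] at h

theorem four_mul_ballDiam_lt_azimuth (n : ℕ) : 4 * ballDiam n < azimuth n := by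
  unfold ballDiam
  linarith [azimuth_pos (n + 1)]

theorem ballDiam_lt_one (n : ℕ) : ballDiam n < 1 := by
  linarith [four_mul_ballDiam_lt_azimuth n, azimuth_lt_one n, ballDiam_pos n]

theorem azimuth_sq_le_four_mul_ballDiam (n : ℕ) : azimuth n ^ 2 ≤ 4 * ballDiam n := by
  have hn : (n : ℝ) + 2 ≤ Real.pi * (n + 1) := by
    nlinarith [Real.pi_gt_three, n.cast_nonneg (α := ℝ)]
  calc azimuth n ^ 2 = 1 / (Real.pi * (n + 1) * (Real.pi * (n + 1))) := by
        rw [azimuth, div_pow]; ring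
    _ ≤ 1 / (Real.pi * (n + 1) * (n + 2)) := by gcongr
    _ = 4 * ballDiam n := by rw [ballDiam_eq]; field_simp

theorem four_mul_ballDiam_le_azimuth_sub {m n : ℕ} (hmn : m < n) :
    4 * ballDiam m ≤ azimuth m - azimuth n := by
  have hn : azimuth n ≤ azimuth (m + 1) := azimuth_strictAnti.antitone hmn
  unfold ballDiam
  linarith

theorem two_mul_ballDiam_le_abs_azimuth_sub_midAzimuth (m n : ℕ) :
    2 * ballDiam m ≤ |azimuth m - midAzimuth n| := by
  have hn : 2 * ballDiam n = azimuth n - midAzimuth n := by unfold ballDiam midAzimuth; ring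
  have hn' : 2 * ballDiam n = midAzimuth n - azimuth (n + 1) := by
    unfold ballDiam midAzimuth; ring
  rcases lt_trichotomy m n with hmn | rfl | hnm
  · linarith [four_mul_ballDiam_le_azimuth_sub hmn, ballDiam_pos m, ballDiam_pos n,
      le_abs_self (azimuth m - midAzimuth n)]
  · exact hn.trans_le (le_abs_self _)
  · linarith [azimuth_strictAnti.antitone (Nat.succ_le_of_lt hnm), ballDiam_strictAnti hnm,
      neg_abs_le (azimuth m - midAzimuth n)]

theorem midAzimuth_ne_azimuth (m n : ℕ) : midAzimuth n ≠ azimuth m := fun h => by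
  have hgap := two_mul_ballDiam_le_abs_azimuth_sub_midAzimuth m n
  rw [h, sub_self, abs_zero] at hgap
  linarith [ballDiam_pos m]

theorem angle_q_q (m n : ℕ) : angle (q m : E3) (q n) = |azimuth m - azimuth n| :=
  angle_equator_equator <| (abs_sub_le_of_nonneg_of_le (azimuth_pos m).le (azimuth_lt_one m).le
    (azimuth_pos n).le (azimuth_lt_one n).le).trans (by linarith [Real.pi_gt_three])

theorem angle_q_p (m n : ℕ) : angle (q m : E3) (p n) = |azimuth m - midAzimuth n| :=
  angle_equator_equator <| (abs_sub_le_of_nonneg_of_le (azimuth_pos m).le (azimuth_lt_one m).le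
    (midAzimuth_pos n).le (midAzimuth_lt_one n).le).trans (by linarith [Real.pi_gt_three])

end Azimuth

/-- The bound `ν n` on the height of the bump over `V n`. -/
noncomputable def bumpHeight (n : ℕ) : ℝ := ballDiam n / 8

theorem disjoint_closure_V_of_lt {m n : ℕ} (hmn : m < n) :
    Disjoint (closure (V ballDiam m)) (closure (V ballDiam n)) := by
  refine disjoint_closure_geoBall ?_
  rw [angle_q_q]
  linarith [four_mul_ballDiam_le_azimuth_sub hmn, ballDiam_strictAnti hmn, ballDiam_pos n,
    le_abs_self (azimuth m - azimuth n)]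

theorem isChoice_bumpHeight_ballDiam : IsChoice bumpHeight ballDiam where
  ν_pos n := div_pos (ballDiam_pos n) (by norm_num)
  ν_anti _ _ hmn := div_lt_div_of_pos_right (ballDiam_strictAnti hmn) (by norm_num)
  ν_lim := by
    have h := tendsto_ballDiam.div_const 8
    rwa [zero_div] at h
  ε_pos := ballDiam_pos
  ε_anti := ballDiam_strictAnti
  ε_lim := tendsto_ballDiam
  p_notMem m n hm := by
    have hle : angle (q n : E3) (p m) ≤ ballDiam n / 2 := angle_le_of_mem_closure_geoBall hm
    rw [angle_q_p] at hle
    linarith [two_mul_ballDiam_le_abs_azimuth_sub_midAzimuth n m, ballDiam_pos n]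
  disj m n hmn := by
    rcases hmn.lt_or_gt with hlt | hgt
    · exact disjoint_closure_V_of_lt hlt
    · exact (disjoint_closure_V_of_lt hgt).symm

section Bump

theorem exists_contMDiff_support_eq_inter_le {E H M : Type*} [NormedAddCommGroup E]
    [NormedSpace ℝ E] [FiniteDimensional ℝ E] [TopologicalSpace H] (I : ModelWithCorners ℝ E H)
    [TopologicalSpace M] [ChartedSpace H M] [IsManifold I ∞ M] [SigmaCompactSpace M] [T2Space M]
    {U : Set M} (hU : IsOpen U) {w : M → ℝ} (hw : ContMDiff I 𝓘(ℝ, ℝ) ∞ w) (hw0 : ∀ x, 0 ≤ w x) :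
    ∃ f : M → ℝ, ContMDiff I 𝓘(ℝ, ℝ) ∞ f ∧ (∀ x, 0 ≤ f x) ∧ (∀ x, f x ≤ w x) ∧
      Function.support f = U ∩ Function.support w := by
  obtain ⟨χ, hχ, hχ_mem, hχU, -⟩ :=
    exists_contMDiff_support_eq_eq_one_iff I (n := ⊤) hU isClosed_empty (empty_subset U)
  have hχ_mem : ∀ x, χ x ∈ Icc 0 1 := fun x => hχ_mem (mem_range_self x)
  exact ⟨fun x => χ x * w x, hχ.mul hw, fun x => mul_nonneg (hχ_mem x).1 (hw0 x),
    fun x => mul_le_of_le_one_left (hw0 x) (hχ_mem x).2, by rw [Function.support_mul, hχU]⟩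

theorem coord_q (n : ℕ) : (q n : E3) 1 = Real.sin (azimuth n) := by simp [q, pt]

theorem abs_coord_le_of_mem_V {n : ℕ} {x : S2} (hx : x ∈ V ballDiam n) :
    |(x : E3) 1| ≤ 2 * azimuth n := by
  have hxq : |(x : E3) 1 - (q n : E3) 1| < ballDiam n / 2 := by
    calc |(x : E3) 1 - (q n : E3) 1| ≤ ‖(x : E3) - (q n : E3)‖ :=
          PiLp.norm_apply_le ((x : E3) - (q n : E3)) 1
      _ = ‖(q n : E3) - x‖ := norm_sub_rev _ _
      _ ≤ angle (q n : E3) x :=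
          norm_sub_le_angle (norm_eq_of_mem_sphere _) (norm_eq_of_mem_sphere _)
      _ < ballDiam n / 2 := hx
  have hq : |(q n : E3) 1| ≤ azimuth n := by
    rw [coord_q]
    exact Real.abs_sin_le_abs.trans_eq (abs_of_pos (azimuth_pos n))
  linarith [abs_sub_abs_le_abs_sub ((x : E3) 1) ((q n : E3) 1), four_mul_ballDiam_lt_azimuth n,
    ballDiam_pos n]

theorem exists_isBump : ∃ f : S2 → ℝ, IsBump bumpHeight ballDiam f := by
  have : Fact (Module.finrank ℝ E3 = 2 + 1) := ⟨by simp⟩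
  -- The second coordinate vanishes at the limit of the points `q n`, and its square is of the order
  -- of `azimuth n ^ 2`, hence of `ballDiam n`, on `V ballDiam n`.
  have hw : ContMDiff (𝓡 2) 𝓘(ℝ, ℝ) ∞ fun x : S2 => (x : E3) 1 ^ 2 / 128 :=
    (show ContDiff ℝ ∞ fun x : E3 => x 1 ^ 2 / 128 by fun_prop).contMDiff.comp contMDiff_coe_sphere
  obtain ⟨f, hf, hf0, hfw, hfsupp⟩ := exists_contMDiff_support_eq_inter_le (𝓡 2)
    (isOpen_iUnion fun n => isOpen_geoBall (q n) (ballDiam n / 2)) hw fun x => by positivity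
  refine ⟨f, hf, hf0, fun x hx => ?_, fun n => ?_, fun n x hx => ?_⟩
  · refine Function.notMem_support.1 fun hfx => ?_
    obtain ⟨n, hn⟩ := mem_iUnion.1 (hfsupp ▸ hfx).1
    exact hx n hn
  · have hsin : 0 < Real.sin (azimuth n) := Real.sin_pos_of_pos_of_lt_pi (azimuth_pos n)
      (by linarith [azimuth_lt_one n, Real.pi_gt_three])
    refine (hf0 _).lt_of_ne' (Function.mem_support.1 (hfsupp ▸ ⟨mem_iUnion.2 ⟨n, ?_⟩, ?_⟩))
    · exact mem_geoBall_self (half_pos (ballDiam_pos n))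
    · rw [Function.mem_support, coord_q]
      positivity
  · calc f x ≤ (x : E3) 1 ^ 2 / 128 := hfw x
      _ ≤ (2 * azimuth n) ^ 2 / 128 := by
        gcongr ?_ / _
        exact sq_le_sq.2 ((abs_coord_le_of_mem_V hx).trans (le_abs_self _))
      _ ≤ bumpHeight n := by
        unfold bumpHeight
        linarith [azimuth_sq_le_four_mul_ballDiam n]

theorem le_of_forall_lt_notMem {α : Type*} {ν : ℕ → ℝ} (hν : Antitone ν) {W : ℕ → Set α}
    {f : α → ℝ} (hf_out : ∀ x, (∀ n, x ∉ W n) → f x ≤ 0) (hf_le : ∀ n, ∀ x ∈ W n, f x ≤ ν n)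
    {k : ℕ} (hk : 0 ≤ ν k) {x : α} (hx : ∀ j < k, x ∉ W j) : f x ≤ ν k := by
  by_cases hW : ∃ j, x ∈ W j
  · obtain ⟨j, hj⟩ := hW
    exact (hf_le j x hj).trans (hν (not_lt.1 fun hjk => hx j hjk hj))
  · exact (hf_out x (not_exists.1 hW)).trans hk

end Bump

theorem IsBaseFactor.one_lt_p {Ω : S2 → ℝ} (hΩ : IsBaseFactor Ω) (n : ℕ) : 1 < Ω (p n) := by
  obtain ⟨ε₁, _, hε₁, -, -, -, hband⟩ := hΩ.band
  exact hband (Real.pi / 2) (midAzimuth n) (by simpa using hε₁) (midAzimuth_pos n)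
    (by linarith [midAzimuth_lt_one n, Real.pi_gt_three]) fun m => midAzimuth_ne_azimuth m n

section PoleToPole

variable {h : S2 → ℝ} {γ : ℝ → S2} {a b t : ℝ}

theorem pi_lt_conformalLength_of_one_lt_equator (hγ : AbsolutelyContinuousOnInterval γ a b)
    (ha : γ a = northPole) (hb : γ b = southPole) (ht : t ∈ Icc a b) {φ : ℝ}
    (htφ : γ t = pt (Real.pi / 2) φ) (hh : LowerSemicontinuous h)
    (hone : ∀ u ∈ Icc a b, 1 ≤ h (γ u)) (hφ : 1 < h (pt (Real.pi / 2) φ)) :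
    ENNReal.ofReal Real.pi < conformalLength h γ a b := by
  have hat : angle (γ a : E3) (γ t) = Real.pi / 2 := by rw [ha, htφ, angle_northPole_equator]
  have htb : angle (γ t : E3) (γ b) = Real.pi / 2 := by rw [hb, htφ, angle_equator_southPole]
  have hne : γ a ≠ γ t := fun heq => by
    rw [heq, angle_coe_self] at hat
    exact Real.pi_div_two_pos.ne hat
  have hac : uIcc a b = Icc a b := uIcc_of_le (ht.1.trans ht.2)
  have hfirst : ENNReal.ofReal (Real.pi / 2) < conformalLength h γ a t := by
    rw [← hat]
    exact ofReal_angle_lt_conformalLength ht.1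
      (hγ.mono (uIcc_subset_uIcc_left (hac ▸ ht))) hh
      (fun u hu => hone u ⟨hu.1, hu.2.trans ht.2⟩) hne (by rwa [htφ])
  have hsecond : ENNReal.ofReal (Real.pi / 2) ≤ conformalLength h γ t b := by
    have hround := ofReal_sqrt_mul_angle_le_conformalLength ht.2
      (hγ.mono (uIcc_subset_uIcc_right (hac ▸ ht))) fun u hu => hone u ⟨ht.1.trans hu.1, hu.2⟩
    rwa [Real.sqrt_one, one_mul, htb] at hround
  calc ENNReal.ofReal Real.pi
      = ENNReal.ofReal (Real.pi / 2) + ENNReal.ofReal (Real.pi / 2) := by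
        rw [← ENNReal.ofReal_add (by positivity) (by positivity), add_halves]
    _ < conformalLength h γ a t + conformalLength h γ t b :=
        ENNReal.add_lt_add_of_lt_of_le ENNReal.ofReal_ne_top hfirst hsecond
    _ = conformalLength h γ a b := conformalLength_add ht.1 ht.2

theorem pi_lt_sqrt_mul_pi_add {δ : ℝ} (hδ : 0 < δ) (hδ_lt : δ < 1) :
    Real.pi < √(1 - δ / 8) * (Real.pi + δ) := by
  have hsqrt : 1 - δ / 8 ≤ √(1 - δ / 8) := Real.le_sqrt_of_sq_le (by nlinarith)
  calc Real.pi < (1 - δ / 8) * (Real.pi + δ) := by nlinarith [Real.pi_lt_four]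
    _ ≤ √(1 - δ / 8) * (Real.pi + δ) := by gcongr

theorem pi_lt_conformalLength_of_mem_V (hγ : AbsolutelyContinuousOnInterval γ a b)
    (ha : γ a = northPole) (hb : γ b = southPole) {s : ℝ} (hs : s ∈ Icc a b) (ht : t ∈ Icc a b)
    {k n : ℕ} (hsV : γ s ∈ V ballDiam k) (htp : γ t = p n)
    (hh : ∀ u ∈ Icc a b, 1 - bumpHeight k ≤ h (γ u)) :
    ENNReal.ofReal Real.pi < conformalLength h γ a b := by
  have hsq : angle (q k : E3) (γ s) < ballDiam k / 2 := hsV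
  have htp' : angle (p n : E3) (γ t) = 0 := by rw [htp, angle_coe_self]
  have hqp : 2 * ballDiam k ≤ angle (q k : E3) (p n) :=
    angle_q_p k n ▸ two_mul_ballDiam_le_abs_azimuth_sub_midAzimuth k n
  suffices hpath : ∃ u ∈ Icc a b, ∃ v ∈ Icc a b, u ≤ v ∧ Real.pi + ballDiam k ≤
      angle (northPole : E3) (γ u) + angle (γ u : E3) (γ v) + angle (γ v : E3) southPole by
    obtain ⟨u, hu, v, hv, huv, hdetour⟩ := hpath
    refine lt_of_lt_of_le ?_ (ofReal_three_arcs_le_conformalLength hγ hh hu hv huv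
      fun r hr => hh r ⟨hu.1.trans hr.1, hr.2.trans hv.2⟩)
    rw [ENNReal.ofReal_lt_ofReal_iff_of_nonneg Real.pi_pos.le, ← mul_add, ← mul_add, ha, hb]
    exact (pi_lt_sqrt_mul_pi_add (ballDiam_pos k) (ballDiam_lt_one k)).trans_le
      (mul_le_mul_of_nonneg_left hdetour (Real.sqrt_nonneg _))
  rcases le_total s t with hst | hts
  · refine ⟨s, hs, t, ht, hst, le_trans ?_ (pi_add_angle_equator_sub_le (azimuth k) (midAzimuth n)
      (γ s) (γ t))⟩
    change _ ≤ Real.pi + angle (q k : E3) (p n) - 2 * (angle (q k : E3) (γ s) +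
      angle (p n : E3) (γ t))
    linarith
  · refine ⟨t, ht, s, hs, hts, le_trans ?_ (pi_add_angle_equator_sub_le (midAzimuth n) (azimuth k)
      (γ t) (γ s))⟩
    change _ ≤ Real.pi + angle (p n : E3) (q k) - 2 * (angle (p n : E3) (γ t) +
      angle (q k : E3) (γ s))
    linarith [angle_comm (p n : E3) (q k)]

end PoleToPole

end SphereExample

open SphereExample in
theorem claim3p2_general :
    ∃ ν ε : ℕ → ℝ, IsChoice ν ε ∧ (∃ f : S2 → ℝ, IsBump ν ε f) ∧
      ∀ Ω f : S2 → ℝ, LowerSemicontinuous Ω → (∀ x, 1 ≤ Ω x) → (∀ n, 1 < Ω (p n)) →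
        (∀ x, (∀ n, x ∉ V ε n) → f x ≤ 0) → (∀ n, ∀ x ∈ V ε n, f x ≤ ν n) →
        (∀ x, 0 < Ω x - f x) ∧
        ∀ (a b : ℝ) (γ : ℝ → S2), AbsolutelyContinuousOnInterval γ a b →
          γ a = northPole → γ b = southPole → (∃ n, ∃ t ∈ Icc a b, γ t = p n) →
          ENNReal.ofReal Real.pi < conformalLength (fun x => Ω x - f x) γ a b := by
  have hchoice := isChoice_bumpHeight_ballDiam
  refine ⟨bumpHeight, ballDiam, hchoice, exists_isBump,
    fun Ω f hΩ hone hp hf_out hf_le => ⟨fun x => ?_, fun a b γ hγ ha hb ⟨n, t, ht, htp⟩ => ?_⟩⟩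
  · have hfx : f x ≤ bumpHeight 0 := le_of_forall_lt_notMem hchoice.ν_anti.antitone hf_out hf_le
      (hchoice.ν_pos 0).le (by simp)
    unfold bumpHeight at hfx
    linarith [hone x, ballDiam_lt_one 0]
  · by_cases hvisit : ∃ k, ∃ s ∈ Icc a b, γ s ∈ V ballDiam k
    · classical
      obtain ⟨s, hs, hsV⟩ := Nat.find_spec hvisit
      refine pi_lt_conformalLength_of_mem_V hγ ha hb hs ht hsV htp fun u hu => ?_
      have hfu := le_of_forall_lt_notMem hchoice.ν_anti.antitone hf_out hf_le
        (hchoice.ν_pos _).le fun j hj hV => Nat.find_min hvisit hj ⟨u, hu, hV⟩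
      linarith [hone (γ u)]
    · push Not at hvisit
      refine (pi_lt_conformalLength_of_one_lt_equator hγ ha hb ht htp hΩ
        (fun u _ => hone (γ u)) (hp n)).trans_le (conformalLength_mono fun u hu => ?_)
      linarith [hf_out (γ u) fun k => hvisit k u hu]

theorem claim3p2 (Ω : SphereExample.S2 → ℝ) (hΩ : SphereExample.IsBaseFactor Ω) :
    ∃ ν ε : ℕ → ℝ, SphereExample.IsChoice ν ε ∧
      (∃ f : SphereExample.S2 → ℝ, SphereExample.IsBump ν ε f) ∧
      ∀ f : SphereExample.S2 → ℝ, SphereExample.IsBump ν ε f →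
        (∀ x, 0 < Ω x - f x) ∧
        ∀ (a b : ℝ) (γ : ℝ → SphereExample.S2), a ≤ b → AbsolutelyContinuousOnInterval γ a b →
          ¬ ((γ a = SphereExample.northPole ∧ γ b = SphereExample.southPole) ∧
            (∃ n : ℕ, ∃ t ∈ Set.Icc a b, γ t = SphereExample.p n) ∧
            SphereExample.conformalLength (fun x => Ω x - f x) γ a b
              ≤ ENNReal.ofReal Real.pi) := by
  obtain ⟨ν, ε, hchoice, hbump, hgen⟩ := claim3p2_general
  refine ⟨ν, ε, hchoice, hbump, fun f hf => ?_⟩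
  obtain ⟨hpos, hlen⟩ := hgen Ω f hΩ.smooth.continuous.lowerSemicontinuous hΩ.one_le hΩ.one_lt_p
    (fun x hx => (hf.eq_zero x hx).le) hf.le
  exact ⟨hpos, fun a b γ _ hγ ⟨⟨ha, hb⟩, hp, hle⟩ => hle.not_gt (hlen a b γ hγ ha hb hp)⟩
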